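/- Let $N\ge 1$ be an integer, $1<p<\infty$, $0<s<1$ and $R>0$. For measurable $u:\mathbb{R}^N\to\mathbb{R}$ put \[ [u]_{D^{s,p}(\mathbb{R}^N)}=\left(\int_{\mathbb{R}^{N}}\int_{\mathbb{R}^{N}}\frac{|u(x)-u(y)|^p}{|x-y|^{N+sp}}\,dx\,dy\right)^{1/p}. \] Let $B_R\subset\mathbb{R}^N$ be the open ball of radius $R$ centered at the origin, and let $D^{s,p}_{0,\mathrm{rad}}(B_R)$ be the space, normed by $[\,\cdot\,]_{D^{s,p}(\mathbb{R}^N)}$, of all radial measurable functions $u:\mathbb{R}^N\to\mathbb{R}$ (that is, $u(x)=f(|x|)$ for a.e. $x$, for some measurable $f$) such that $[u]_{D^{s,p}(\mathbb{R}^N)}<\infty$, $u=0$ a.e. in $\mathbb{R}^N\setminus B_R$ and, if $sp<N$, $u\in L^{Np/(N-sp)}(\mathbb{R}^N)$; functions that agree a.e. are identified. Set \[ p^\#_s=\begin{cases}\dfrac{p}{1-sp},&\text{if } sp<1,\\[2mm] +\infty,&\text{if } sp\ge 1.\end{cases} \] Then for every $1\le q<p^\#_s$ and every bounded open set $K\subset\mathbb{R}^N$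 whose closure is compact and contained in $\mathbb{R}^N\setminus\{0\}$, the restriction map $u\mapsto u|_K$ is a compact embedding \[ D^{s,p}_{0,\mathrm{rad}}(B_R)\hookrightarrow L^q(K), \] that is: every $u\in D^{s,p}_{0,\mathrm{rad}}(B_R)$ belongs to $L^q(K)$, there is a constant $C$, independent of $u$, such that $\|u\|_{L^q(K)}\le C\,[u]_{D^{s,p}(\mathbb{R}^N)}$ for all such $u$, and for every $M\geq 0$ the set $\{u|_K : u\in D^{s,p}_{0,\mathrm{rad}}(B_R),\ [u]_{D^{s,p}(\mathbb{R}^N)}\le M\}$ is relatively compact in $L^q(K)$. -/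

import Mathlib

open MeasureTheory
open scoped ENNReal NNReal

noncomputable section

/-- The Gagliardo seminorm `(∫∫ |u(x) - u(y)|^p / |x - y|^(N + s p) dx dy)^(1/p)` on `ℝ^N`,
with values in `[0, ∞]`. On the diagonal, a null set, the integrand is `0`. -/
def gagliardo (N : ℕ) (s p : ℝ) (u : EuclideanSpace ℝ (Fin N) → ℝ) : ℝ≥0∞ :=
  (∫⁻ z : EuclideanSpace ℝ (Fin N) × EuclideanSpace ℝ (Fin N),
    ENNReal.ofReal (|u z.1 - u z.2| ^ p / ‖z.1 - z.2‖ ^ ((N : ℝ) + s * p))) ^ (1 / p)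

/-- The functions that represent elements of `D_0^{s,p}(Ω)`, for bounded `Ω` and every `s p`:
measurable functions on `ℝ^N` with finite Gagliardo seminorm that vanish a.e. outside `Ω` and,
if `s p < N`, lie in `L^{p*}(ℝ^N)` with `p* = N p / (N - s p)`. For `s p ≥ N`, where `p*` has no
meaning, nothing is added (for bounded `Ω` the other conditions already force `u ∈ L^p(ℝ^N)`). -/
structure MemD0 (N : ℕ) (s p : ℝ) (Ω : Set (EuclideanSpace ℝ (Fin N)))
    (u : EuclideanSpace ℝ (Fin N) → ℝ) : Prop where
  aestronglyMeasurable : AEStronglyMeasurable u volume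
  memLp_critical : s * p < N → MemLp u (ENNReal.ofReal (N * p / (N - s * p))) volume
  gagliardo_lt_top : gagliardo N s p u < ∞
  eq_zero_outside : ∀ᵐ x, x ∉ Ω → u x = 0

/-- `u` is radial: `u(x) = f(|x|)` for a.e. `x`, for a measurable profile `f`. -/
def IsRadialFun (N : ℕ) (u : EuclideanSpace ℝ (Fin N) → ℝ) : Prop :=
  ∃ f : ℝ → ℝ, Measurable f ∧ ∀ᵐ x : EuclideanSpace ℝ (Fin N), u x = f ‖x‖

/-- `D_{0,rad}^{s,p}(B_R)`: the radial functions of `D_0^{s,p}(B_R)`; its norm is `gagliardo`. -/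
def D0rad (N : ℕ) (s p R : ℝ) : Set (EuclideanSpace ℝ (Fin N) → ℝ) :=
  {u | MemD0 N s p (Metric.ball 0 R) u ∧ IsRadialFun N u}

/-- The one-dimensional Sobolev exponent: `p / (1 - s p)` if `s p < 1`, and `∞` otherwise. -/
def pSharp (s p : ℝ) : ℝ≥0∞ :=
  if s * p < 1 then ENNReal.ofReal (p / (1 - s * p)) else ∞

/-- `K ⋐ E`: `K` is open and bounded, with compact closure contained in `E`. -/
structure CompactlyContained {X : Type*} [PseudoMetricSpace X] (K E : Set X) : Prop where
  isOpen : IsOpen K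
  isBounded : Bornology.IsBounded K
  isCompact_closure : IsCompact (closure K)
  closure_subset : closure K ⊆ E

/-- The class `X` of functions, normed by `nrm`, embeds compactly into `L^q(μ)`: every `u ∈ X`
defines an element of `L^q(μ)`, the resulting map is bounded, and it maps `nrm`-bounded sets to
relatively compact subsets of `L^q(μ)`. -/
structure EmbedsCompactly {α : Type*} [MeasurableSpace α] (X : Set (α → ℝ))
    (nrm : (α → ℝ) → ℝ≥0∞) (q : ℝ≥0∞) [Fact (1 ≤ q)] (μ : Measure α) : Prop where
  memLp : ∀ u ∈ X, MemLp u q μ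
  bound : ∃ C : ℝ≥0, ∀ u ∈ X, eLpNorm u q μ ≤ C * nrm u
  compact : ∀ M : ℝ≥0,
    IsCompact (closure {f : Lp ℝ q μ | ∃ u ∈ X, nrm u ≤ M ∧ (f : α → ℝ) =ᵐ[μ] u})

end

/-! ### Spherical shells. -/

section Shell

/-! Away from the origin a radial function depends on one variable ranging over a compact interval,
so the one-dimensional exponent governs, provided that the N-dimensional Gagliardo seminorm controls
one-dimensional oscillation. This is `exists_poincare_shell`. Fix x in a shell S of thickness h. The
part of S within 2h of x carries a fraction of order h^(N-1) of the integral over S of any radial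
function (`exists_mul_setLIntegral_shell_le`), and there the kernel is at least (2h)^(-N-sp) |u(x) -
u(y)|^p. Choosing x where the inner Gagliardo integral is at most its mean over S, and using |S| ≥
mh, bounds the p-th power of the oscillation by h^(sp) times the energy of S.

On an annulus cut into 2^k shells, u is thus approximated in L^p by a step function P_k with error
of order 2^(-sk). The cells have measure at least of order 2^(-k), so passing from L^p to L^q on
step functions costs 2^(k(1/p - 1/q)) (`eLpNorm_step_le`). For 1/p - 1/q < s, which is the
subcritical condition, the increments P_(k+1) - P_k decay geometrically in L^q, and summing them
bounds u - P_k in L^q (`exists_eLpNorm_radial_le`). Since P_k lies in a space of dimension at most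
2^k that does not depend on u, bounded sets are totally bounded. The norm bound follows from the
same estimate at k = 0, where P_0 is controlled because u vanishes outside the ball. -/

/-- The spherical shell of radii in `[ρ, ρ + h)`. -/
def shell (E : Type*) [NormedAddCommGroup E] (ρ h : ℝ) : Set E :=
  (fun y => ‖y‖) ⁻¹' Set.Ico ρ (ρ + h)

theorem measurableSet_shell {E : Type*} [NormedAddCommGroup E] [MeasurableSpace E]
    [OpensMeasurableSpace E] (ρ h : ℝ) : MeasurableSet (shell E ρ h) :=
  measurable_norm measurableSet_Ico

theorem setLIntegral_shell_inter {E : Type*} [NormedAddCommGroup E] [MeasurableSpace E]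
    [BorelSpace E] (μ : Measure E) {S : Set E} (ρ h : ℝ) (g : ℝ → ℝ≥0∞) :
    ∫⁻ y in shell E ρ h ∩ S, g ‖y‖ ∂μ =
      ∫⁻ y in S, (Set.Ico ρ (ρ + h)).indicator g ‖y‖ ∂μ := by
  rw [← Measure.restrict_restrict (measurableSet_shell ρ h),
    ← lintegral_indicator (measurableSet_shell ρ h)]
  rfl

theorem measure_shell_lt_top {E : Type*} [NormedAddCommGroup E] [NormedSpace ℝ E]
    [FiniteDimensional ℝ E] [MeasurableSpace E] (μ : Measure E) [μ.IsAddHaarMeasure]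
    (ρ h : ℝ) : μ (shell E ρ h) < ∞ := by
  refine lt_of_le_of_lt (measure_mono fun y hy => ?_)
    (measure_ball_lt_top (μ := μ) (x := (0 : E)) (r := ρ + h))
  simpa using hy.2

end Shell

/-! ### Polar coordinates, spherical caps and localization of radial integrals. -/

section Polar

variable {E : Type*} [NormedAddCommGroup E] [NormedSpace ℝ E] [MeasurableSpace E] [BorelSpace E]
  [FiniteDimensional ℝ E] [Nontrivial E] (μ : Measure E) [μ.IsAddHaarMeasure]

/-- The integral of a radial function over the cone spanned by the part of the sphere in `T`. -/
theorem lintegral_cone_fun_norm {T : Set E} (hT : MeasurableSet T) {g : ℝ → ℝ≥0∞}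
    (hg : Measurable g) :
    ∫⁻ y in {y | ‖y‖⁻¹ • y ∈ T}, g ‖y‖ ∂μ =
      μ.toSphere (Subtype.val ⁻¹' T) *
        ∫⁻ r, g r.1 ∂(Measure.volumeIoiPow (Module.finrank ℝ E - 1)) := by
  have hcone : MeasurableSet {y : E | ‖y‖⁻¹ • y ∈ T} :=
    (show Measurable fun y : E => ‖y‖⁻¹ • y by fun_prop) hT
  have hF : Measurable fun z : Metric.sphere (0 : E) 1 × Set.Ioi (0 : ℝ) =>
      (Subtype.val ⁻¹' T : Set (Metric.sphere (0 : E) 1)).indicator (fun _ => (1 : ℝ≥0∞)) z.1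
        * g z.2.1 := by
    refine Measurable.mul ?_ (by fun_prop)
    exact (measurable_const.indicator (measurable_subtype_coe hT)).comp measurable_fst
  rw [← lintegral_indicator hcone]
  conv_lhs => rw [← restrict_compl_singleton (μ := μ) 0,
    ← lintegral_subtype_comap (measurableSet_singleton _).compl]
  have h := (μ.measurePreserving_homeomorphUnitSphereProd).lintegral_comp hF
  rw [lintegral_prod_mul (f := (Subtype.val ⁻¹' T : Set (Metric.sphere (0 : E) 1)).indicator
      (fun _ => (1 : ℝ≥0∞))) (g := fun r : Set.Ioi (0 : ℝ) => g r.1)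
    (measurable_const.indicator (measurable_subtype_coe hT)).aemeasurable
    (by fun_prop), lintegral_indicator_const (measurable_subtype_coe hT), one_mul] at h
  rw [← h]
  refine lintegral_congr fun y => ?_
  by_cases hy : ‖y.1‖⁻¹ • y.1 ∈ T
  · rw [Set.indicator_of_mem (by exact hy), Set.indicator_of_mem (by simpa using hy)]; simp
  · rw [Set.indicator_of_notMem (by exact hy), Set.indicator_of_notMem (by simpa using hy)]; simp

theorem volumeIoiPow_preimage (n : ℕ) {A : Set ℝ} (hA : MeasurableSet A) (h0 : A ⊆ Set.Ioi 0) :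
    Measure.volumeIoiPow n (Subtype.val ⁻¹' A) = ∫⁻ r in A, ENNReal.ofReal (r ^ n) := by
  rw [Measure.volumeIoiPow, withDensity_apply _ (measurable_subtype_coe hA),
    setLIntegral_subtype measurableSet_Ioi _ fun a : ℝ => ENNReal.ofReal (a ^ n),
    Subtype.image_preimage_coe, Set.inter_eq_right.2 h0]

theorem volumeIoiPow_Ico_le (n : ℕ) {a h b : ℝ} (ha : 0 < a) (hb : a + h ≤ b) :
    Measure.volumeIoiPow n (Subtype.val ⁻¹' Set.Ico a (a + h)) ≤
      ENNReal.ofReal (b ^ n) * ENNReal.ofReal h := by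
  rw [volumeIoiPow_preimage n measurableSet_Ico fun x hx => ha.trans_le hx.1]
  calc _ ≤ ∫⁻ r in Set.Ico a (a + h), ENNReal.ofReal (b ^ n) := by
        refine setLIntegral_mono measurable_const fun r hr => ENNReal.ofReal_le_ofReal ?_
        exact pow_le_pow_left₀ (ha.le.trans hr.1) (hr.2.le.trans hb) n
    _ = _ := by simp

theorem le_volumeIoiPow_Ico (n : ℕ) {a h c : ℝ} (hc : 0 < c) (hca : c ≤ a) :
    ENNReal.ofReal (c ^ n) * ENNReal.ofReal h ≤
      Measure.volumeIoiPow n (Subtype.val ⁻¹' Set.Ico a (a + h)) := by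
  rw [volumeIoiPow_preimage n measurableSet_Ico fun x hx => hc.trans_le (hca.trans hx.1)]
  calc _ = ∫⁻ r in Set.Ico a (a + h), ENNReal.ofReal (c ^ n) := by simp
    _ ≤ _ := by
        refine setLIntegral_mono (by fun_prop) fun r hr => ENNReal.ofReal_le_ofReal ?_
        exact pow_le_pow_left₀ hc.le (hca.trans hr.1) n

/-- A spherical cap of radius `η ≤ 1` has measure at least `c η ^ (n - 1)`. -/
theorem exists_le_toSphere_closedBall :
    ∃ c : ℝ, 0 < c ∧ ∀ (x : E), ‖x‖ = 1 → ∀ η : ℝ, 0 < η → η ≤ 1 →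
      ENNReal.ofReal (c * η ^ (Module.finrank ℝ E - 1)) ≤
        μ.toSphere (Subtype.val ⁻¹' Metric.closedBall x η) := by
  set d := Module.finrank ℝ E with hd
  have hd0 : 0 < d := Module.finrank_pos
  set V := (μ (Metric.ball (0 : E) 1)).toReal with hV
  have hVpos : 0 < V := ENNReal.toReal_pos (Metric.measure_ball_pos μ 0 one_pos).ne'
    measure_ball_lt_top.ne
  -- The ball of radius η/2 about x, of volume (η/2)^d V, lies in the cone over the cap, cut to a
  -- radial window of length η where the density r^(d-1) is at most 2^(d-1).
  refine ⟨V / (2 ^ d * 2 ^ (d - 1)), by positivity, fun x hx η hη hη1 => ?_⟩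
  have hsub : Metric.ball x (η / 2) ⊆
      {y | ‖y‖⁻¹ • y ∈ Metric.closedBall x η} ∩
        (fun y : E => ‖y‖) ⁻¹' Set.Ico (1 - η / 2) (1 - η / 2 + η) := by
    intro y hy
    rw [Metric.mem_ball, dist_eq_norm] at hy
    have h1 : |‖y‖ - 1| ≤ ‖y - x‖ := by simpa [hx] using abs_norm_sub_norm_le y x
    have h2 := abs_le.1 h1
    have hy0 : 0 < ‖y‖ := by linarith [h2.1]
    refine ⟨?_, ?_, ?_⟩
    · rw [Set.mem_ofPred_eq, Metric.mem_closedBall, dist_eq_norm]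
      have h3 : ‖‖y‖⁻¹ • y - y‖ = |‖y‖ - 1| := by
        have : ‖y‖⁻¹ • y - y = (‖y‖⁻¹ - 1) • y := by rw [sub_smul, one_smul]
        rw [this, norm_smul, Real.norm_eq_abs, ← abs_of_pos hy0, ← abs_mul, abs_of_pos hy0,
          sub_mul, inv_mul_cancel₀ hy0.ne', one_mul, abs_sub_comm]
      calc ‖‖y‖⁻¹ • y - x‖ ≤ ‖‖y‖⁻¹ • y - y‖ + ‖y - x‖ := norm_sub_le_norm_sub_add_norm_sub _ _ _
        _ ≤ η := by rw [h3]; linarith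
    · linarith [h2.1]
    · linarith [h2.2]
  have hnorm : MeasurableSet ((fun y : E => ‖y‖) ⁻¹' Set.Ico (1 - η / 2) (1 - η / 2 + η)) :=
    measurable_norm measurableSet_Ico
  have key : ENNReal.ofReal ((η / 2) ^ d) * ENNReal.ofReal V ≤
      μ.toSphere (Subtype.val ⁻¹' Metric.closedBall x η) *
        (ENNReal.ofReal (2 ^ (d - 1)) * ENNReal.ofReal η) := by
    calc _ = μ (Metric.ball x (η / 2)) := by
          rw [μ.addHaar_ball_of_pos x (by positivity), hV,
            ENNReal.ofReal_toReal measure_ball_lt_top.ne]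
      _ ≤ _ := measure_mono hsub
      _ = ∫⁻ y in {y | ‖y‖⁻¹ • y ∈ Metric.closedBall x η},
            (Set.Ico (1 - η / 2) (1 - η / 2 + η)).indicator 1 ‖y‖ ∂μ := by
          rw [Set.inter_comm, ← Measure.restrict_apply hnorm, ← lintegral_indicator_one hnorm]
          rfl
      _ = _ := lintegral_cone_fun_norm μ measurableSet_closedBall
          (measurable_one.indicator measurableSet_Ico)
      _ ≤ _ := by
          gcongr
          have : ∀ r : Set.Ioi (0 : ℝ),
              (Set.Ico (1 - η / 2) (1 - η / 2 + η)).indicator (1 : ℝ → ℝ≥0∞) r.1 =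
              (Subtype.val ⁻¹' Set.Ico (1 - η / 2) (1 - η / 2 + η) :
                Set (Set.Ioi (0 : ℝ))).indicator 1 r := fun r => rfl
          simp_rw [this]
          rw [lintegral_indicator_one (measurable_subtype_coe measurableSet_Ico)]
          exact volumeIoiPow_Ico_le _ (by linarith) (by linarith)
  have hfin : ENNReal.ofReal (2 ^ (d - 1)) * ENNReal.ofReal η ≠ ∞ := by finiteness
  have hne : ENNReal.ofReal (2 ^ (d - 1)) * ENNReal.ofReal η ≠ 0 := by
    simp only [ne_eq, mul_eq_zero, ENNReal.ofReal_eq_zero, not_or, not_le]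
    exact ⟨by positivity, hη⟩
  rw [← ENNReal.div_le_iff hne hfin] at key
  refine le_trans (le_of_eq ?_) key
  rw [← ENNReal.ofReal_mul (by positivity), ← ENNReal.ofReal_mul (by positivity),
    ← ENNReal.ofReal_div_of_pos (by positivity)]
  congr 1
  obtain ⟨m, hm⟩ : ∃ m, d = m + 1 := ⟨d - 1, by omega⟩
  rw [hm, Nat.add_sub_cancel, div_pow]
  field_simp
  ring

theorem setLIntegral_shell (ρ h : ℝ) {g : ℝ → ℝ≥0∞} (hg : Measurable g) :
    ∫⁻ y in shell E ρ h, g ‖y‖ ∂μ = μ.toSphere Set.univ *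
      ∫⁻ r, (Set.Ico ρ (ρ + h)).indicator g r.1
        ∂(Measure.volumeIoiPow (Module.finrank ℝ E - 1)) := by
  have h1 := lintegral_cone_fun_norm μ (T := Set.univ) MeasurableSet.univ
    (hg.indicator (measurableSet_Ico (a := ρ) (b := ρ + h)))
  rw [Set.preimage_univ] at h1
  rw [← h1, ← setLIntegral_shell_inter]
  simp

theorem measure_shell (ρ h : ℝ) :
    μ (shell E ρ h) = μ.toSphere Set.univ *
      Measure.volumeIoiPow (Module.finrank ℝ E - 1) (Subtype.val ⁻¹' Set.Ico ρ (ρ + h)) := by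
  have h1 := setLIntegral_shell μ ρ h (g := fun _ => 1) measurable_const
  rw [setLIntegral_one] at h1
  rw [h1, ← lintegral_indicator_one (measurable_subtype_coe measurableSet_Ico)]
  rfl

theorem toSphere_univ_pos_lt_top : μ.toSphere Set.univ ≠ 0 ∧ μ.toSphere Set.univ ≠ ∞ :=
  ⟨Measure.measure_univ_ne_zero.2 μ.toSphere_ne_zero, measure_ne_top _ _⟩

theorem exists_le_measure_shell {a : ℝ} (ha : 0 < a) :
    ∃ m : ℝ, 0 < m ∧ ∀ ρ h : ℝ, a ≤ ρ → ENNReal.ofReal (m * h) ≤ μ (shell E ρ h) := by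
  have hσ := toSphere_univ_pos_lt_top μ
  refine ⟨(μ.toSphere Set.univ).toReal * a ^ (Module.finrank ℝ E - 1),
    mul_pos (ENNReal.toReal_pos hσ.1 hσ.2) (by positivity), fun ρ h hρ => ?_⟩
  rw [measure_shell, mul_assoc, ENNReal.ofReal_mul ENNReal.toReal_nonneg,
    ENNReal.ofReal_toReal hσ.2, ENNReal.ofReal_mul (by positivity)]
  gcongr
  exact le_volumeIoiPow_Ico _ ha hρ

/-- The integral of a radial function over a thin shell is controlled by its integral over the
part of the shell near any of its points. -/
theorem exists_mul_setLIntegral_shell_le (b : ℝ) (hb : 0 < b) :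
    ∃ c : ℝ, 0 < c ∧ ∀ (ρ h : ℝ) (x : E) (g : ℝ → ℝ≥0∞), Measurable g → 0 < ρ → 0 < h →
      ρ + h ≤ b → x ∈ shell E ρ h →
      ENNReal.ofReal (c * h ^ (Module.finrank ℝ E - 1)) * ∫⁻ y in shell E ρ h, g ‖y‖ ∂μ ≤
        ∫⁻ y in shell E ρ h ∩ Metric.closedBall x (2 * h), g ‖y‖ ∂μ := by
  obtain ⟨c, hc, hcap⟩ := exists_le_toSphere_closedBall μ
  have hσ := toSphere_univ_pos_lt_top μ
  set σ := (μ.toSphere Set.univ).toReal with hσdef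
  have hσpos : 0 < σ := ENNReal.toReal_pos hσ.1 hσ.2
  set d := Module.finrank ℝ E
  -- The cone over a cap of radius h/b has the same radial factor as the whole shell, so only the
  -- ratio of the cap's measure to that of the sphere remains.
  refine ⟨c / (b ^ (d - 1) * σ), by positivity, fun ρ h x g hg hρ hh hρb hx => ?_⟩
  have hx0 : 0 < ‖x‖ := hρ.trans_le hx.1
  have hxb : ‖x‖ ≤ b := hx.2.le.trans hρb
  set I := ∫⁻ r, (Set.Ico ρ (ρ + h)).indicator g r.1 ∂(Measure.volumeIoiPow (d - 1)) with hI
  have hsub : shell E ρ h ∩ {y | ‖y‖⁻¹ • y ∈ Metric.closedBall (‖x‖⁻¹ • x) (h / b)} ⊆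
      shell E ρ h ∩ Metric.closedBall x (2 * h) := by
    rintro y ⟨hy, hyc⟩
    refine ⟨hy, ?_⟩
    rw [Set.mem_ofPred_eq, Metric.mem_closedBall, dist_eq_norm] at hyc
    rw [Metric.mem_closedBall, dist_eq_norm]
    have hy0 : 0 < ‖y‖ := hρ.trans_le hy.1
    -- Radial plus angular displacement: the first is at most the thickness h, the second at most b
    -- · (h/b) = h.
    have h1 : y - x = (‖y‖ - ‖x‖) • (‖y‖⁻¹ • y) + ‖x‖ • (‖y‖⁻¹ • y - ‖x‖⁻¹ • x) := by
      rw [smul_sub, sub_smul, smul_inv_smul₀ hy0.ne', smul_inv_smul₀ hx0.ne']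
      abel
    have h2 : ‖(‖y‖ - ‖x‖) • (‖y‖⁻¹ • y)‖ ≤ h := by
      rw [norm_smul, norm_smul, norm_inv, norm_norm, inv_mul_cancel₀ hy0.ne', mul_one,
        Real.norm_eq_abs, abs_le]
      constructor <;> linarith [hy.1, hy.2, hx.1, hx.2]
    have h3 : ‖‖x‖ • (‖y‖⁻¹ • y - ‖x‖⁻¹ • x)‖ ≤ h := by
      rw [norm_smul, norm_norm]
      calc _ ≤ b * (h / b) := by gcongr
        _ = h := by field_simp
    rw [h1]
    linarith [norm_add_le ((‖y‖ - ‖x‖) • (‖y‖⁻¹ • y)) (‖x‖ • (‖y‖⁻¹ • y - ‖x‖⁻¹ • x))]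
  calc _ = ENNReal.ofReal (c * (h / b) ^ (d - 1)) * I := by
        rw [setLIntegral_shell μ ρ h hg, ← hI, ← mul_assoc, ← ENNReal.ofReal_toReal hσ.2,
          ← hσdef, ← ENNReal.ofReal_mul (by positivity)]
        congr 2
        rw [div_pow]
        field_simp
    _ ≤ μ.toSphere (Subtype.val ⁻¹' Metric.closedBall (‖x‖⁻¹ • x) (h / b)) * I := by
        gcongr
        refine hcap _ ?_ _ (by positivity) ?_
        · rw [norm_smul, norm_inv, norm_norm, inv_mul_cancel₀ hx0.ne']
        · rw [div_le_one hb]; linarith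
    _ = ∫⁻ y in shell E ρ h ∩ {y | ‖y‖⁻¹ • y ∈ Metric.closedBall (‖x‖⁻¹ • x) (h / b)},
          g ‖y‖ ∂μ := by
        rw [setLIntegral_shell_inter, lintegral_cone_fun_norm μ measurableSet_closedBall
          (hg.indicator measurableSet_Ico)]
    _ ≤ _ := lintegral_mono_set hsub

end Polar

theorem eLpNorm_le_of_lintegral_rpow_le {α : Type*} [MeasurableSpace α] {μ : Measure α}
    {g : α → ℝ} {p D : ℝ} {G : ℝ≥0∞} (hp : 0 < p) (hD : 0 ≤ D)
    (h : ∫⁻ x, ENNReal.ofReal (|g x| ^ p) ∂μ ≤ ENNReal.ofReal (D ^ p) * G ^ p) :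
    eLpNorm g (ENNReal.ofReal p) μ ≤ ENNReal.ofReal D * G := by
  rw [eLpNorm_eq_lintegral_rpow_enorm_toReal (by simpa using hp) ENNReal.ofReal_ne_top,
    ENNReal.toReal_ofReal hp.le, one_div, ENNReal.rpow_inv_le_iff hp,
    ENNReal.mul_rpow_of_nonneg _ _ hp.le, ENNReal.ofReal_rpow_of_nonneg hD hp.le]
  refine le_trans (le_of_eq (lintegral_congr fun x => ?_)) h
  rw [← ENNReal.ofReal_rpow_of_nonneg (abs_nonneg _) hp.le, ← Real.norm_eq_abs, ofReal_norm]

theorem le_ofReal_div_mul {a b : ℝ} {X Y : ℝ≥0∞} (ha : 0 < a)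
    (h : ENNReal.ofReal a * X ≤ ENNReal.ofReal b * Y) : X ≤ ENNReal.ofReal (b / a) * Y := by
  rw [ENNReal.ofReal_div_of_pos ha, ENNReal.mul_div_right_comm.symm,
    ENNReal.le_div_iff_mul_le (Or.inl (by simpa using ha)) (Or.inl ENNReal.ofReal_ne_top), mul_comm]
  exact h

/-! ### The Gagliardo kernel and the Poincaré inequality on thin shells. -/

section Gagliardo

variable {N : ℕ} {s p : ℝ}

/-- The integrand of the Gagliardo seminorm. -/
noncomputable def gagliardoKernel (N : ℕ) (s p : ℝ) (u : EuclideanSpace ℝ (Fin N) → ℝ)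
    (x y : EuclideanSpace ℝ (Fin N)) : ℝ≥0∞ :=
  ENNReal.ofReal (|u x - u y| ^ p / ‖x - y‖ ^ ((N : ℝ) + s * p))

theorem measurable_gagliardoKernel {u : EuclideanSpace ℝ (Fin N) → ℝ} (hu : Measurable u) :
    Measurable (Function.uncurry (gagliardoKernel N s p u)) := by
  unfold gagliardoKernel Function.uncurry
  fun_prop

theorem gagliardo_congr {u v : EuclideanSpace ℝ (Fin N) → ℝ} (h : u =ᵐ[volume] v) :
    gagliardo N s p u = gagliardo N s p v := by
  unfold gagliardo
  congr 1
  refine lintegral_congr_ae ?_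
  have h1 := (Measure.quasiMeasurePreserving_fst (μ := (volume : Measure (EuclideanSpace ℝ (Fin N))))
    (ν := (volume : Measure (EuclideanSpace ℝ (Fin N))))).ae_eq_comp h
  have h2 := (Measure.quasiMeasurePreserving_snd (μ := (volume : Measure (EuclideanSpace ℝ (Fin N))))
    (ν := (volume : Measure (EuclideanSpace ℝ (Fin N))))).ae_eq_comp h
  filter_upwards [h1, h2] with z hz1 hz2
  simp only [Function.comp_apply] at hz1 hz2
  rw [hz1, hz2]

theorem gagliardo_rpow (hp : 0 < p) {u : EuclideanSpace ℝ (Fin N) → ℝ} (hu : Measurable u) :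
    gagliardo N s p u ^ p = ∫⁻ x, ∫⁻ y, gagliardoKernel N s p u x y := by
  unfold gagliardo
  rw [one_div, ENNReal.rpow_inv_rpow hp.ne', Measure.volume_eq_prod]
  exact lintegral_prod (Function.uncurry (gagliardoKernel N s p u))
    (measurable_gagliardoKernel hu).aemeasurable

/-- The denominator of the kernel is at most L^(N+sp); on the diagonal both sides vanish. -/
theorem ofReal_abs_sub_rpow_le (hp : 0 < p) (hs : 0 < s) {u : EuclideanSpace ℝ (Fin N) → ℝ}
    {L : ℝ} {x y : EuclideanSpace ℝ (Fin N)} (hxy : ‖x - y‖ ≤ L) :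
    ENNReal.ofReal (|u x - u y| ^ p) ≤
      ENNReal.ofReal (L ^ ((N : ℝ) + s * p)) * gagliardoKernel N s p u x y := by
  have hβ : 0 < (N : ℝ) + s * p := by positivity
  rcases eq_or_ne x y with rfl | hne
  · simp [Real.zero_rpow hp.ne']
  have h0 : 0 < ‖x - y‖ := norm_pos_iff.2 (sub_ne_zero.2 hne)
  have hL : 0 < L := h0.trans_le hxy
  rw [gagliardoKernel, ← ENNReal.ofReal_mul (by positivity)]
  refine ENNReal.ofReal_le_ofReal ?_
  rw [mul_div_assoc', le_div_iff₀ (by positivity), mul_comm]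
  gcongr

/-- Fractional Poincaré inequality for radial functions on thin shells. -/
theorem exists_poincare_shell (hN : 1 ≤ N) (hs : 0 < s) (hp : 0 < p) {a b : ℝ} (ha : 0 < a)
    (hab : a < b) :
    ∃ D : ℝ, 0 < D ∧ ∀ f : ℝ → ℝ, Measurable f → ∀ ρ h : ℝ, a ≤ ρ → 0 < h → ρ + h ≤ b →
      ∃ c : ℝ, ∫⁻ x in shell (EuclideanSpace ℝ (Fin N)) ρ h, ENNReal.ofReal (|f ‖x‖ - c| ^ p) ≤
        ENNReal.ofReal (D * h ^ (s * p)) *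
          ∫⁻ x in shell (EuclideanSpace ℝ (Fin N)) ρ h,
            ∫⁻ y, gagliardoKernel N s p (fun x => f ‖x‖) x y := by
  have : Nonempty (Fin N) := ⟨⟨0, hN⟩⟩
  obtain ⟨c, hc, hshell⟩ := exists_mul_setLIntegral_shell_le
    (volume : Measure (EuclideanSpace ℝ (Fin N))) b (ha.trans hab)
  obtain ⟨m, hm, hmeas⟩ := exists_le_measure_shell
    (volume : Measure (EuclideanSpace ℝ (Fin N))) ha
  simp only [finrank_euclideanSpace, Fintype.card_fin] at hshell
  set β := (N : ℝ) + s * p with hβ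
  refine ⟨2 ^ β / (c * m), by positivity, fun f hf ρ h hρ hh hb => ?_⟩
  set S := shell (EuclideanSpace ℝ (Fin N)) ρ h with hS
  set u : EuclideanSpace ℝ (Fin N) → ℝ := fun x => f ‖x‖ with hu
  have hum : Measurable u := hf.comp measurable_norm
  have hSpos : volume S ≠ 0 := by
    refine (lt_of_lt_of_le ?_ (hmeas ρ h hρ)).ne'
    rw [ENNReal.ofReal_pos]; positivity
  have hSfin : volume S ≠ ∞ := (measure_shell_lt_top volume ρ h).ne
  have hmK : Measurable fun x => ∫⁻ y, gagliardoKernel N s p u x y :=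
    (measurable_gagliardoKernel hum).lintegral_prod_right'
  -- The approximating constant is the value of f at a point whose inner Gagliardo integral does not
  -- exceed its mean over the shell; no average of f is needed.
  obtain ⟨x, hxS, hx⟩ := exists_le_setLAverage hSpos hSfin hmK.aemeasurable
  rw [setLAverage_eq, ENNReal.le_div_iff_mul_le (Or.inl hSpos) (Or.inl hSfin)] at hx
  refine ⟨f ‖x‖, ?_⟩
  have h1 : ENNReal.ofReal (c * h ^ (N - 1)) * ∫⁻ y in S, ENNReal.ofReal (|f ‖y‖ - f ‖x‖| ^ p) ≤
      ENNReal.ofReal ((2 * h) ^ β) * ∫⁻ y, gagliardoKernel N s p u x y := by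
    have hm1 : Measurable fun r : ℝ => ENNReal.ofReal (|f r - f ‖x‖| ^ p) := by fun_prop
    refine (hshell ρ h x (fun r => ENNReal.ofReal (|f r - f ‖x‖| ^ p)) hm1 (ha.trans_le hρ) hh hb
      hxS).trans ?_
    rw [← lintegral_const_mul' _ _ ENNReal.ofReal_ne_top]
    refine (setLIntegral_mono' ((measurableSet_shell ρ h).inter measurableSet_closedBall)
      fun y hy => ?_).trans (setLIntegral_le_lintegral _ _)
    rw [abs_sub_comm]
    refine ofReal_abs_sub_rpow_le (u := u) hp hs ?_
    rw [norm_sub_rev, ← dist_eq_norm]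
    exact hy.2
  refine (le_ofReal_div_mul (by positivity) h1).trans ?_
  -- One power of h beyond h^(sp) is left over; together with m it is absorbed by the measure of the
  -- shell, turning the mean back into an integral.
  have h2 : (2 * h) ^ β / (c * h ^ (N - 1)) = 2 ^ β / (c * m) * h ^ (s * p) * (m * h) := by
    have h3 : h ^ β = h ^ (N - 1) * h * h ^ (s * p) := by
      rw [← pow_succ, Nat.sub_add_cancel hN, hβ, Real.rpow_add hh, Real.rpow_natCast]
    rw [Real.mul_rpow zero_le_two hh.le, h3]
    field_simp
  rw [h2, ENNReal.ofReal_mul (by positivity), mul_assoc]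
  gcongr
  calc _ ≤ volume S * ∫⁻ y, gagliardoKernel N s p u x y := by gcongr; exact hmeas ρ h hρ
    _ ≤ _ := by rw [mul_comm]; exact hx

end Gagliardo

/-! ### The dyadic partition of an annulus. -/

section RadialIndex

/-- The index of the dyadic shell of generation `k` that contains `x`. -/
noncomputable def radialIndex {E : Type*} [NormedAddCommGroup E] (a b : ℝ) (k : ℕ) (x : E) : ℕ :=
  ⌊2 ^ k * ((‖x‖ - a) / (b - a))⌋₊

variable {E : Type*} [NormedAddCommGroup E] {a b : ℝ}

theorem measurable_radialIndex [MeasurableSpace E] [OpensMeasurableSpace E] (k : ℕ) :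
    Measurable (radialIndex (E := E) a b k) := by
  unfold radialIndex
  exact Nat.measurable_floor.comp (by fun_prop)

/-- Nesting of the partitions: a step function of generation k is also one of generation k + 1. -/
theorem radialIndex_succ_div_two (k : ℕ) (x : E) :
    radialIndex a b (k + 1) x / 2 = radialIndex a b k x := by
  unfold radialIndex
  rw [← Nat.floor_div_ofNat, pow_succ]
  congr 1
  ring

theorem radialIndex_lt (hab : a < b) (k : ℕ) {x : E} (hx : x ∈ shell E a (b - a)) :
    radialIndex a b k x < 2 ^ k := by
  have h1 := hx.1
  have h2 := hx.2
  have h0 : 0 < b - a := sub_pos.2 hab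
  unfold radialIndex
  rw [Nat.floor_lt (mul_nonneg (by positivity) (div_nonneg (sub_nonneg.2 h1) h0.le))]
  push_cast
  have : (‖x‖ - a) / (b - a) < 1 := by rw [div_lt_one h0]; linarith
  nlinarith [pow_pos (two_pos : (0 : ℝ) < 2) k]

/-- The intersection with the annulus is needed because the natural-number floor sends all radii
below a to index 0. -/
theorem shell_inter_radialIndex (hab : a < b) {k j : ℕ} (hj : j < 2 ^ k) :
    shell E a (b - a) ∩ radialIndex a b k ⁻¹' {j} =
      shell E (a + j * ((b - a) / 2 ^ k)) ((b - a) / 2 ^ k) := by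
  obtain ⟨h, hh, hba⟩ : ∃ h : ℝ, 0 < h ∧ b - a = 2 ^ k * h :=
    ⟨(b - a) / 2 ^ k, div_pos (sub_pos.2 hab) (by positivity), by field_simp⟩
  have hj' : (j : ℝ) + 1 ≤ 2 ^ k := by exact_mod_cast hj
  have hdiv : (b - a) / 2 ^ k = h := by rw [hba]; field_simp
  rw [hdiv]
  ext x
  have hidx : a ≤ ‖x‖ →
      (radialIndex a b k x = j ↔ a + j * h ≤ ‖x‖ ∧ ‖x‖ < a + j * h + h) := by
    intro hx
    have hq : 2 ^ k * ((‖x‖ - a) / (b - a)) = (‖x‖ - a) / h := by rw [hba]; field_simp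
    rw [radialIndex, hq, Nat.floor_eq_iff (div_nonneg (sub_nonneg.2 hx) hh.le), le_div_iff₀ hh,
      div_lt_iff₀ hh, add_mul, one_mul, le_sub_iff_add_le', sub_lt_iff_lt_add', add_assoc]
  constructor
  · rintro ⟨hx, hxj⟩
    exact (hidx hx.1).1 hxj
  · rintro ⟨hx1, hx2⟩
    have hx : a ≤ ‖x‖ := le_trans (le_add_of_nonneg_right (by positivity)) hx1
    refine ⟨⟨hx, hx2.trans_le ?_⟩, (hidx hx).2 ⟨hx1, hx2⟩⟩
    rw [hba]
    nlinarith

theorem shell_inter_radialIndex_eq_empty (hab : a < b) {k j : ℕ} (hj : ¬ j < 2 ^ k) :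
    shell E a (b - a) ∩ radialIndex a b k ⁻¹' {j} = ∅ := by
  rw [Set.eq_empty_iff_forall_notMem]
  rintro x ⟨hx, rfl⟩
  exact hj (radialIndex_lt hab k hx)

end RadialIndex

theorem setLIntegral_eq_tsum_fiber {α : Type*} [MeasurableSpace α] {μ : Measure α} {A : Set α}
    (hA : MeasurableSet A) {idx : α → ℕ} (hidx : Measurable idx) (F : α → ℝ≥0∞) :
    ∫⁻ x in A, F x ∂μ = ∑' j, ∫⁻ x in A ∩ idx ⁻¹' {j}, F x ∂μ := by
  rw [← lintegral_iUnion (fun j => hA.inter (hidx (measurableSet_singleton j)))]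
  · congr 2
    ext x
    simp
  · intro i j hij
    refine Set.disjoint_left.2 ?_
    rintro x ⟨_, hx⟩ ⟨_, hy⟩
    exact hij (hx.symm.trans hy)

/-! ### Approximation in L^p by step functions, and size of the cells. -/

section Approximation

variable {N : ℕ} {s p : ℝ}

/-- Approximation of radial functions by functions that are constant on dyadic shells. -/
theorem exists_eLpNorm_sub_radialIndex_le (hN : 1 ≤ N) (hs : 0 < s) (hp : 0 < p) {a b : ℝ}
    (ha : 0 < a) (hab : a < b) :
    ∃ D : ℝ, 0 < D ∧ ∀ f : ℝ → ℝ, Measurable f → ∀ k : ℕ, ∃ c : ℕ → ℝ,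
      eLpNorm (fun x : EuclideanSpace ℝ (Fin N) => f ‖x‖ - c (radialIndex a b k x))
        (ENNReal.ofReal p) (volume.restrict (shell (EuclideanSpace ℝ (Fin N)) a (b - a))) ≤
        ENNReal.ofReal (D * ((2 : ℝ) ^ (-s)) ^ k) * gagliardo N s p (fun x => f ‖x‖) := by
  obtain ⟨D, hD, hpoin⟩ := exists_poincare_shell hN hs hp ha hab
  have h0 : 0 < b - a := sub_pos.2 hab
  -- The p-th root of the Poincaré constant at thickness (b - a)/2^k, with 2^(-sk) split off.
  refine ⟨D ^ (1 / p) * (b - a) ^ s, by positivity, fun f hf k => ?_⟩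
  set u : EuclideanSpace ℝ (Fin N) → ℝ := fun x => f ‖x‖ with hu
  have hum : Measurable u := hf.comp measurable_norm
  set A := shell (EuclideanSpace ℝ (Fin N)) a (b - a) with hA
  have hAm : MeasurableSet A := measurableSet_shell _ _
  have hcell : ∀ j : ℕ, ∃ c : ℝ,
      ∫⁻ x in A ∩ radialIndex a b k ⁻¹' {j}, ENNReal.ofReal (|f ‖x‖ - c| ^ p) ≤
        ENNReal.ofReal (D * ((b - a) / 2 ^ k) ^ (s * p)) *
          ∫⁻ x in A ∩ radialIndex a b k ⁻¹' {j}, ∫⁻ y, gagliardoKernel N s p u x y := by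
    intro j
    by_cases hj : j < 2 ^ k
    · rw [hA, shell_inter_radialIndex hab hj]
      refine hpoin f hf _ _ (le_add_of_nonneg_right (by positivity)) (by positivity) ?_
      have hj' : (j : ℝ) + 1 ≤ 2 ^ k := by exact_mod_cast hj
      calc a + j * ((b - a) / 2 ^ k) + (b - a) / 2 ^ k
          = a + (j + 1) * ((b - a) / 2 ^ k) := by ring
        _ ≤ a + 2 ^ k * ((b - a) / 2 ^ k) := by gcongr
        _ = b := by field_simp; ring
    · rw [hA, shell_inter_radialIndex_eq_empty hab hj]
      simp
  choose c hc using hcell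
  refine ⟨c, eLpNorm_le_of_lintegral_rpow_le hp (by positivity) ?_⟩
  have hconst : (D ^ (1 / p) * (b - a) ^ s * ((2 : ℝ) ^ (-s)) ^ k) ^ p =
      D * ((b - a) / 2 ^ k) ^ (s * p) := by
    rw [mul_assoc, Real.mul_rpow (by positivity) (by positivity), one_div,
      Real.rpow_inv_rpow hD.le hp.ne', Real.rpow_mul (by positivity),
      Real.div_rpow h0.le (by positivity), Real.rpow_neg zero_le_two, inv_pow, div_eq_mul_inv,
      ← Real.rpow_mul_natCast zero_le_two, ← Real.rpow_natCast_mul zero_le_two, mul_comm s]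
  rw [hconst, gagliardo_rpow hp hum, setLIntegral_eq_tsum_fiber hAm (measurable_radialIndex k)]
  calc _ ≤ ∑' j, ENNReal.ofReal (D * ((b - a) / 2 ^ k) ^ (s * p)) *
          ∫⁻ x in A ∩ radialIndex a b k ⁻¹' {j}, ∫⁻ y, gagliardoKernel N s p u x y := by
        refine ENNReal.tsum_le_tsum fun j => le_trans (le_of_eq ?_) (hc j)
        refine setLIntegral_congr_fun
          (hAm.inter (measurable_radialIndex k (measurableSet_singleton j))) fun x hx => ?_
        rw [show radialIndex a b k x = j from hx.2]
    _ = ENNReal.ofReal (D * ((b - a) / 2 ^ k) ^ (s * p)) *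
          ∫⁻ x in A, ∫⁻ y, gagliardoKernel N s p u x y := by
        rw [ENNReal.tsum_mul_left, ← setLIntegral_eq_tsum_fiber hAm (measurable_radialIndex k)]
    _ ≤ _ := by gcongr; exact Measure.restrict_le_self

/-- `L^p` bound for functions supported in a ball by the Gagliardo seminorm. -/
theorem exists_eLpNorm_le_gagliardo (hN : 1 ≤ N) (hs : 0 < s) (hp : 0 < p) {a b R : ℝ} (ha : 0 < a)
    (hab : a < b) (hR : 0 < R) :
    ∃ D : ℝ, 0 < D ∧ ∀ u : EuclideanSpace ℝ (Fin N) → ℝ, Measurable u →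
      (∀ᵐ x, x ∉ Metric.ball 0 R → u x = 0) →
      eLpNorm u (ENNReal.ofReal p)
        (volume.restrict (shell (EuclideanSpace ℝ (Fin N)) a (b - a))) ≤
        ENNReal.ofReal D * gagliardo N s p u := by
  have : Nonempty (Fin N) := ⟨⟨0, hN⟩⟩
  obtain ⟨m, hm, hmeas⟩ := exists_le_measure_shell
    (volume : Measure (EuclideanSpace ℝ (Fin N))) hR
  -- Since u vanishes a.e. on R ≤ |y| < 2R, there |u(x)| = |u(x) - u(y)|; integrating over these y
  -- and using |x - y| ≤ L = b + 2R gives the bound.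
  set T := shell (EuclideanSpace ℝ (Fin N)) R R with hT
  have hb : 0 < b := ha.trans hab
  set L := b + 2 * R with hL
  have hL0 : 0 < L := by positivity
  refine ⟨(L ^ ((N : ℝ) + s * p) / (m * R)) ^ (1 / p), by positivity, fun u hu h0 => ?_⟩
  refine eLpNorm_le_of_lintegral_rpow_le hp (by positivity) ?_
  rw [one_div, Real.rpow_inv_rpow (by positivity) hp.ne', gagliardo_rpow hp hu]
  refine le_ofReal_div_mul (by positivity) ?_
  rw [← lintegral_const_mul' _ _ ENNReal.ofReal_ne_top,
    ← lintegral_const_mul' _ _ ENNReal.ofReal_ne_top]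
  refine (setLIntegral_mono' (measurableSet_shell _ _) fun x hx => ?_).trans
    (setLIntegral_le_lintegral _ _)
  calc _ ≤ volume T * ENNReal.ofReal (|u x| ^ p) := by gcongr; exact hmeas R R le_rfl
    _ = ∫⁻ y in T, ENNReal.ofReal (|u x| ^ p) := by rw [setLIntegral_const, mul_comm]
    _ ≤ ∫⁻ y in T, ENNReal.ofReal (L ^ ((N : ℝ) + s * p)) * gagliardoKernel N s p u x y := by
        refine lintegral_mono_ae ?_
        filter_upwards [ae_restrict_mem (measurableSet_shell R R), ae_restrict_of_ae h0]
          with y hyT hy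
        have huy : u y = 0 := hy (by simpa using hyT.1)
        have := ofReal_abs_sub_rpow_le (N := N) (L := L) (u := u) (x := x) (y := y) hp hs ?_
        · rwa [huy, sub_zero] at this
        · have h1 := norm_sub_le x y
          have h2 := hx.2
          have h3 := hyT.2
          linarith
    _ ≤ ∫⁻ y, ENNReal.ofReal (L ^ ((N : ℝ) + s * p)) * gagliardoKernel N s p u x y :=
        setLIntegral_le_lintegral _ _
    _ = _ := lintegral_const_mul' _ _ ENNReal.ofReal_ne_top

/-- The dyadic cells are not too small. -/
theorem exists_le_measure_radialIndex (hN : 1 ≤ N) {a b : ℝ} (ha : 0 < a) (hab : a < b) :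
    ∃ m : ℝ, 0 < m ∧ ∀ (k : ℕ), ∀ x ∈ shell (EuclideanSpace ℝ (Fin N)) a (b - a),
      ENNReal.ofReal (m / 2 ^ k) ≤
        volume.restrict (shell (EuclideanSpace ℝ (Fin N)) a (b - a))
          (radialIndex a b k ⁻¹' {radialIndex a b k x}) := by
  have : Nonempty (Fin N) := ⟨⟨0, hN⟩⟩
  have h0 : 0 < b - a := sub_pos.2 hab
  obtain ⟨m, hm, hmeas⟩ := exists_le_measure_shell
    (volume : Measure (EuclideanSpace ℝ (Fin N))) ha
  refine ⟨m * (b - a), by positivity, fun k x hx => ?_⟩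
  rw [Measure.restrict_apply (measurable_radialIndex k (measurableSet_singleton _)),
    Set.inter_comm, shell_inter_radialIndex hab (radialIndex_lt hab k hx), mul_div_assoc]
  exact hmeas _ _ (le_add_of_nonneg_right (by positivity))

end Approximation

/-! ### Compactness from uniform finite-dimensional approximation. -/

/-- The approximants lie in a closed ball of a finite-dimensional space, which is compact; a finite
net for that ball serves for S. -/
theorem isCompact_closure_of_forall_finiteDimensional {F : Type*} [NormedAddCommGroup F]
    [NormedSpace ℝ F] [CompleteSpace F] {S : Set F} (hB : ∃ B : ℝ, ∀ f ∈ S, ‖f‖ ≤ B)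
    (happ : ∀ ε > 0, ∃ V : Submodule ℝ F, FiniteDimensional ℝ V ∧
      ∀ f ∈ S, ∃ g ∈ V, ‖f - g‖ ≤ ε) : IsCompact (closure S) := by
  suffices h : TotallyBounded S from
    isCompact_iff_totallyBounded_isComplete.2 ⟨h.closure, isClosed_closure.isComplete⟩
  rw [Metric.totallyBounded_iff]
  intro ε hε
  obtain ⟨B, hB⟩ := hB
  obtain ⟨V, hV, hSV⟩ := happ (ε / 3) (by positivity)
  have hcomp : IsCompact ((↑) '' Metric.closedBall (0 : V) (B + ε / 3) : Set F) :=
    (isCompact_closedBall (0 : V) (B + ε / 3)).image continuous_subtype_val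
  obtain ⟨t, ht, hcov⟩ := Metric.totallyBounded_iff.1 hcomp.totallyBounded (ε / 3) (by positivity)
  refine ⟨t, ht, fun f hf => ?_⟩
  obtain ⟨g, hgV, hfg⟩ := hSV f hf
  have hg : g ∈ ((↑) '' Metric.closedBall (0 : V) (B + ε / 3) : Set F) := by
    refine ⟨⟨g, hgV⟩, ?_, rfl⟩
    rw [mem_closedBall_zero_iff, Submodule.coe_norm]
    have := norm_sub_norm_le g f
    rw [norm_sub_rev] at this
    linarith [hB f hf]
  obtain ⟨y, hy, hgy⟩ := Set.mem_iUnion₂.1 (hcov hg)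
  refine Set.mem_iUnion₂.2 ⟨y, hy, ?_⟩
  rw [Metric.mem_ball] at hgy ⊢
  have := dist_triangle f g y
  rw [dist_eq_norm f g] at this
  linarith

/-! ### Step functions: finite dimension, inverse inequality, geometric series. -/

section StepFunctions

variable {α : Type*} [MeasurableSpace α] {μ : Measure α}

theorem exists_finiteDimensional_step [IsFiniteMeasure μ] (q : ℝ≥0∞) [Fact (1 ≤ q)]
    {idx : α → ℕ} (hidx : Measurable idx) {n : ℕ} (hn : ∀ᵐ x ∂μ, idx x < n) :
    ∃ V : Submodule ℝ (Lp ℝ q μ), FiniteDimensional ℝ V ∧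
      ∀ w : ℕ → ℝ, ∃ g ∈ V, (g : α → ℝ) =ᵐ[μ] fun x => w (idx x) := by
  have hmem : ∀ w : Fin n → ℝ,
      MemLp (fun x => if h : idx x < n then w ⟨idx x, h⟩ else 0) q μ := by
    intro w
    refine MemLp.of_bound (Measurable.aestronglyMeasurable ?_) ‖w‖ (Filter.Eventually.of_forall ?_)
    · exact (measurable_from_nat (f := fun i => if h : i < n then w ⟨i, h⟩ else 0)).comp hidx
    · intro x
      split_ifs with h
      · exact norm_le_pi_norm w _
      · simp
  let L : (Fin n → ℝ) →ₗ[ℝ] Lp ℝ q μ :=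
    { toFun := fun w => (hmem w).toLp
      map_add' := fun w v => by
        rw [← MemLp.toLp_add]
        refine MemLp.toLp_congr _ _ (Filter.Eventually.of_forall fun x => ?_)
        by_cases h : idx x < n <;> simp [h]
      map_smul' := fun r w => by
        rw [RingHom.id_apply, ← MemLp.toLp_const_smul]
        refine MemLp.toLp_congr _ _ (Filter.Eventually.of_forall fun x => ?_)
        by_cases h : idx x < n <;> simp [h] }
  refine ⟨LinearMap.range L, inferInstance, fun w => ⟨L fun i => w i, ⟨_, rfl⟩, ?_⟩⟩
  filter_upwards [(hmem fun i => w i).coeFn_toLp, hn] with x hx hxn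
  exact hx.trans (by simp [hxn])

/-- Inverse inequality for functions that are constant on cells of measure at least `M`. -/
theorem eLpNorm_step_le {p q : ℝ} (hp : 0 < p) (hpq : p ≤ q) {idx : α → ℕ} (hidx : Measurable idx)
    {M : ℝ≥0∞} (hM0 : M ≠ 0) (hM : M ≠ ∞) (hcell : ∀ᵐ x ∂μ, M ≤ μ (idx ⁻¹' {idx x}))
    (w : ℕ → ℝ) :
    eLpNorm (fun x => w (idx x)) (ENNReal.ofReal q) μ ≤
      M ^ (-(1 / p - 1 / q)) * eLpNorm (fun x => w (idx x)) (ENNReal.ofReal p) μ := by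
  have hq : 0 < q := hp.trans_le hpq
  set X := eLpNorm (fun x => w (idx x)) (ENNReal.ofReal p) μ with hX
  have hXp : ∫⁻ x, ‖w (idx x)‖ₑ ^ p ∂μ = X ^ p := by
    rw [hX, eLpNorm_eq_lintegral_rpow_enorm_toReal (by simpa using hp) ENNReal.ofReal_ne_top,
      ENNReal.toReal_ofReal hp.le, one_div, ENNReal.rpow_inv_rpow hp.ne']
  -- A cell of measure at least M on which the function is constant bounds the value there by the
  -- L^p norm; L^q then follows by interpolating between L^p and the supremum.
  have hsup : ∀ᵐ x ∂μ, ‖w (idx x)‖ₑ ≤ M ^ (-(1 / p)) * X := by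
    filter_upwards [hcell] with x hx
    have h1 : M * ‖w (idx x)‖ₑ ^ p ≤ X ^ p := by
      calc _ ≤ μ (idx ⁻¹' {idx x}) * ‖w (idx x)‖ₑ ^ p := by gcongr
        _ = ∫⁻ y in idx ⁻¹' {idx x}, ‖w (idx y)‖ₑ ^ p ∂μ := by
          rw [mul_comm, ← setLIntegral_const]
          refine setLIntegral_congr_fun (hidx (measurableSet_singleton _)) fun y hy => ?_
          rw [show idx y = idx x from hy]
        _ ≤ _ := hXp ▸ setLIntegral_le_lintegral _ _
    have h2 : ‖w (idx x)‖ₑ ^ p ≤ (M ^ (-(1 / p)) * X) ^ p := by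
      rw [ENNReal.mul_rpow_of_nonneg _ _ hp.le, ← ENNReal.rpow_mul, neg_mul,
        one_div_mul_cancel hp.ne', ENNReal.rpow_neg_one, mul_comm, ← div_eq_mul_inv,
        ENNReal.le_div_iff_mul_le (Or.inl hM0) (Or.inl hM), mul_comm]
      exact h1
    exact (ENNReal.rpow_le_rpow_iff hp).1 h2
  have hint : ∫⁻ x, ‖w (idx x)‖ₑ ^ q ∂μ ≤ (M ^ (-(1 / p)) * X) ^ (q - p) * X ^ p := by
    have hm : Measurable fun x => ‖w (idx x)‖ₑ ^ p :=
      (measurable_from_nat (f := fun i => ‖w i‖ₑ ^ p)).comp hidx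
    rw [← hXp, ← lintegral_const_mul _ hm]
    refine lintegral_mono_ae ?_
    filter_upwards [hsup] with x hx
    calc ‖w (idx x)‖ₑ ^ q = ‖w (idx x)‖ₑ ^ (q - p) * ‖w (idx x)‖ₑ ^ p := by
          rw [← ENNReal.rpow_add_of_nonneg _ _ (sub_nonneg.2 hpq) hp.le, sub_add_cancel]
      _ ≤ _ := by gcongr
  rw [eLpNorm_eq_lintegral_rpow_enorm_toReal (by simpa using hq) ENNReal.ofReal_ne_top,
    ENNReal.toReal_ofReal hq.le, one_div, ENNReal.rpow_inv_le_iff hq]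
  refine hint.trans (le_of_eq ?_)
  rw [ENNReal.mul_rpow_of_nonneg _ _ (sub_nonneg.2 hpq), mul_assoc,
    ← ENNReal.rpow_add_of_nonneg _ _ (sub_nonneg.2 hpq) hp.le, sub_add_cancel,
    ENNReal.mul_rpow_of_nonneg _ _ hq.le, ← ENNReal.rpow_mul, ← ENNReal.rpow_mul]
  congr 2
  field_simp

/-- Telescoping bounds P_n - P_k in L^q uniformly in n. Convergence in L^p yields an a.e. convergent
subsequence, and Fatou's lemma carries the bound to u, with no prior knowledge that u is in L^q. For
r ≥ 1 truncated subtraction makes the last factor infinite. -/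
theorem eLpNorm_sub_le_of_geometric {p q : ℝ≥0∞} (hp : p ≠ 0) (hq : 1 ≤ q) {u : α → ℝ}
    {P : ℕ → α → ℝ} (hu : AEStronglyMeasurable u μ) (hP : ∀ k, AEStronglyMeasurable (P k) μ)
    (hlim : Filter.Tendsto (fun k => eLpNorm (P k - u) p μ) Filter.atTop (nhds 0))
    {B r : ℝ≥0∞} (hstep : ∀ k, eLpNorm (P (k + 1) - P k) q μ ≤ B * r ^ k) (k : ℕ) :
    eLpNorm (u - P k) q μ ≤ B * r ^ k * (1 - r)⁻¹ := by
  have hfin : ∀ n, eLpNorm (P (k + n) - P k) q μ ≤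
      B * r ^ k * ∑ i ∈ Finset.range n, r ^ i := by
    intro n
    induction n with
    | zero => simp
    | succ n ih =>
      have h1 : P (k + (n + 1)) - P k = (P (k + n) - P k) + (P (k + n + 1) - P (k + n)) := by
        rw [← add_assoc]; abel
      rw [h1, Finset.sum_range_succ, mul_add]
      refine (eLpNorm_add_le ((hP _).sub (hP _)) ((hP _).sub (hP _)) hq).trans ?_
      refine add_le_add ih ((hstep (k + n)).trans (le_of_eq ?_))
      rw [pow_add, mul_assoc]
  have hbound : ∀ n, k ≤ n → eLpNorm (P n - P k) q μ ≤ B * r ^ k * (1 - r)⁻¹ := by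
    intro n hn
    obtain ⟨i, rfl⟩ := Nat.exists_eq_add_of_le hn
    refine (hfin i).trans ?_
    gcongr
    rw [← ENNReal.tsum_geometric]
    exact ENNReal.sum_le_tsum _
  obtain ⟨ns, hns, hae⟩ := (tendstoInMeasure_of_tendsto_eLpNorm hp hP hu hlim).exists_seq_tendsto_ae
  refine (Lp.eLpNorm_lim_le_liminf_eLpNorm (f := fun j => P (ns j) - P k)
    (fun j => (hP _).sub (hP _)) (u - P k) ?_).trans ?_
  · filter_upwards [hae] with x hx
    exact hx.sub_const _
  · refine Filter.liminf_le_of_frequently_le' (Filter.Eventually.frequently ?_)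
    filter_upwards [hns.tendsto_atTop.eventually_ge_atTop k] with j hj
    exact hbound _ hj

end StepFunctions

/-! ### The L^q estimate on annuli and the reduction to it. -/

section Embedding

variable {N : ℕ} {s p : ℝ}

/-- On an annulus, radial functions are approximated in `L^q` at a geometric rate, uniformly in the
Gagliardo seminorm, by functions that are constant on dyadic shells. -/
theorem exists_eLpNorm_radial_le (hN : 1 ≤ N) (hs : 0 < s) (hp : 1 ≤ p) {q : ℝ} (hpq : p ≤ q)
    (hsq : 1 / p - 1 / q < s) {a b R : ℝ} (ha : 0 < a) (hab : a < b) (hR : 0 < R) :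
    ∃ C r : ℝ≥0∞, C ≠ ∞ ∧ r < 1 ∧ ∀ f : ℝ → ℝ, Measurable f →
      (∀ᵐ x : EuclideanSpace ℝ (Fin N), x ∉ Metric.ball 0 R → f ‖x‖ = 0) →
      gagliardo N s p (fun x => f ‖x‖) ≠ ∞ →
      eLpNorm (fun x : EuclideanSpace ℝ (Fin N) => f ‖x‖) (ENNReal.ofReal q)
        (volume.restrict (shell (EuclideanSpace ℝ (Fin N)) a (b - a))) ≤
          C * gagliardo N s p (fun x => f ‖x‖) ∧
      ∀ k : ℕ, ∃ c : ℕ → ℝ,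
        eLpNorm (fun x : EuclideanSpace ℝ (Fin N) => f ‖x‖ - c (radialIndex a b k x))
          (ENNReal.ofReal q)
          (volume.restrict (shell (EuclideanSpace ℝ (Fin N)) a (b - a))) ≤
            C * r ^ k * gagliardo N s p (fun x => f ‖x‖) := by
  have hp0 : 0 < p := one_pos.trans_le hp
  obtain ⟨D, hD, happ⟩ := exists_eLpNorm_sub_radialIndex_le hN hs hp0 ha hab
  obtain ⟨D', hD', hbd⟩ := exists_eLpNorm_le_gagliardo hN hs hp0 ha hab hR
  obtain ⟨m, hm, hcell⟩ := exists_le_measure_radialIndex hN ha hab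
  set A := shell (EuclideanSpace ℝ (Fin N)) a (b - a) with hA
  set μ := (volume : Measure (EuclideanSpace ℝ (Fin N))).restrict A with hμ
  set γ := 1 / p - 1 / q with hγ
  set t : ℝ := 2 ^ (-s) with ht
  have ht0 : 0 < t := by positivity
  have ht1 : t < 1 := Real.rpow_lt_one_of_one_lt_of_neg one_lt_two (by linarith)
  have hp1 : 1 ≤ ENNReal.ofReal p := ENNReal.one_le_ofReal.2 hp
  have hq1 : 1 ≤ ENNReal.ofReal q := ENNReal.one_le_ofReal.2 (hp.trans hpq)
  have hinv : ∀ (k : ℕ) (w : ℕ → ℝ),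
      eLpNorm (fun x => w (radialIndex a b k x)) (ENNReal.ofReal q) μ ≤
        ENNReal.ofReal ((m / 2 ^ k) ^ (-γ)) *
          eLpNorm (fun x => w (radialIndex a b k x)) (ENNReal.ofReal p) μ := by
    intro k w
    have hmk : 0 < m / 2 ^ k := by positivity
    rw [← ENNReal.ofReal_rpow_of_pos hmk]
    refine eLpNorm_step_le hp0 hpq (measurable_radialIndex k) (by simpa using hmk)
      ENNReal.ofReal_ne_top ?_ w
    filter_upwards [ae_restrict_mem (measurableSet_shell a (b - a))] with x hx
    exact hcell k x hx
  -- Each generation gains t = 2^(-s) from the approximation and loses 2^γ in the inverse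
  -- inequality; γ < s makes the product less than 1.
  set r := ENNReal.ofReal (2 ^ γ * t) with hr
  have hr1 : r < 1 := by
    rw [hr, ENNReal.ofReal_lt_one, ht, ← Real.rpow_add two_pos]
    exact Real.rpow_lt_one_of_one_lt_of_neg one_lt_two (by linarith)
  -- C₁ sums the geometric tail; C₂ bounds P_0, which is constant on the annulus.
  set C₁ := ENNReal.ofReal ((m / 2) ^ (-γ) * (2 * D)) * (1 - r)⁻¹ with hC₁
  set C₂ := ENNReal.ofReal ((m / 2 ^ 0) ^ (-γ)) * (ENNReal.ofReal D' + ENNReal.ofReal D) with hC₂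
  have hC₁f : C₁ ≠ ∞ := ENNReal.mul_ne_top ENNReal.ofReal_ne_top
    (ENNReal.inv_ne_top.2 (tsub_pos_of_lt hr1).ne')
  have hC₂f : C₂ ≠ ∞ := by finiteness
  refine ⟨C₁ + C₂, r, by finiteness, hr1, fun f hf h0 hG => ?_⟩
  set u : EuclideanSpace ℝ (Fin N) → ℝ := fun x => f ‖x‖ with hu
  set G := gagliardo N s p u with hGdef
  have hum : Measurable u := hf.comp measurable_norm
  choose c hc using happ f hf
  set P : ℕ → EuclideanSpace ℝ (Fin N) → ℝ := fun k x => c k (radialIndex a b k x) with hP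
  have hPm : ∀ k, AEStronglyMeasurable (P k) μ := fun k =>
    (measurable_from_nat.comp (measurable_radialIndex k)).aestronglyMeasurable
  have hus : AEStronglyMeasurable u μ := hum.aestronglyMeasurable
  have hc' : ∀ k, eLpNorm (u - P k) (ENNReal.ofReal p) μ ≤ ENNReal.ofReal (D * t ^ k) * G := hc
  have hc'' : ∀ k, eLpNorm (P k - u) (ENNReal.ofReal p) μ ≤ ENNReal.ofReal (D * t ^ k) * G :=
    fun k => by rw [eLpNorm_sub_comm]; exact hc' k
  have hlim : Filter.Tendsto (fun k => eLpNorm (P k - u) (ENNReal.ofReal p) μ) Filter.atTop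
      (nhds 0) := by
    refine tendsto_of_tendsto_of_tendsto_of_le_of_le tendsto_const_nhds ?_
      (fun _ => zero_le) hc''
    have h1 : Filter.Tendsto (fun k => ENNReal.ofReal (D * t ^ k)) Filter.atTop (nhds 0) := by
      rw [← ENNReal.ofReal_zero, ← mul_zero D]
      exact ENNReal.tendsto_ofReal
        ((tendsto_pow_atTop_nhds_zero_of_lt_one ht0.le ht1).const_mul D)
    simpa using ENNReal.Tendsto.mul_const h1 (Or.inr hG)
  have hstep : ∀ k, eLpNorm (P (k + 1) - P k) (ENNReal.ofReal q) μ ≤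
      (ENNReal.ofReal ((m / 2) ^ (-γ) * (2 * D)) * G) * r ^ k := by
    intro k
    -- By nesting, the increment is a step function of generation k + 1, so the inverse inequality
    -- applies to it.
    have h1 : P (k + 1) - P k = fun x =>
        (fun i => c (k + 1) i - c k (i / 2)) (radialIndex a b (k + 1) x) := by
      funext x
      simp only [hP, Pi.sub_apply, radialIndex_succ_div_two]
    have h2 : eLpNorm (P (k + 1) - P k) (ENNReal.ofReal p) μ ≤
        ENNReal.ofReal (2 * D * t ^ k) * G := by
      have h3 : P (k + 1) - P k = (P (k + 1) - u) + (u - P k) := by abel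
      rw [h3]
      refine (eLpNorm_add_le ((hPm _).sub hus) (hus.sub (hPm _)) hp1).trans ?_
      refine (add_le_add (hc'' (k + 1)) (hc' k)).trans ?_
      rw [← add_mul, ← ENNReal.ofReal_add (by positivity) (by positivity)]
      gcongr
      have : t ^ (k + 1) ≤ t ^ k := pow_le_pow_of_le_one ht0.le ht1.le (Nat.le_succ k)
      nlinarith
    have h4 := hinv (k + 1) fun i => c (k + 1) i - c k (i / 2)
    rw [← h1] at h4
    refine h4.trans ((mul_le_mul_right h2 _).trans (le_of_eq ?_))
    rw [← mul_assoc, ← ENNReal.ofReal_mul (by positivity),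
      mul_right_comm (ENNReal.ofReal ((m / 2) ^ (-γ) * (2 * D))), hr,
      ← ENNReal.ofReal_pow (by positivity), ← ENNReal.ofReal_mul (by positivity)]
    congr 2
    have h5 : (m / 2 ^ (k + 1)) ^ (-γ) = (m / 2) ^ (-γ) * (2 ^ γ) ^ k := by
      rw [pow_succ', ← div_div, div_eq_mul_inv (m / 2), Real.mul_rpow (by positivity)
        (by positivity), Real.rpow_neg (by positivity : (0 : ℝ) ≤ (2 ^ k)⁻¹),
        Real.inv_rpow (by positivity), inv_inv, ← Real.rpow_natCast_mul zero_le_two,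
        ← Real.rpow_mul_natCast zero_le_two, mul_comm (k : ℝ)]
    rw [h5, mul_pow]
    ring
  have hq_sub : ∀ k, eLpNorm (u - P k) (ENNReal.ofReal q) μ ≤ C₁ * r ^ k * G := by
    intro k
    refine (eLpNorm_sub_le_of_geometric (one_pos.trans_le hp1).ne' hq1 hus hPm hlim hstep
      k).trans (le_of_eq ?_)
    rw [hC₁]
    ring
  constructor
  · have h1 : eLpNorm (P 0) (ENNReal.ofReal p) μ ≤
        (ENNReal.ofReal D' + ENNReal.ofReal D) * G := by
      have h2 : P 0 = u + (P 0 - u) := by abel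
      rw [h2, add_mul]
      refine (eLpNorm_add_le hus ((hPm _).sub hus) hp1).trans (add_le_add (hbd u hum h0) ?_)
      simpa using hc'' 0
    have h3 : eLpNorm (P 0) (ENNReal.ofReal q) μ ≤ C₂ * G := by
      refine (hinv 0 (c 0)).trans ?_
      rw [hC₂, mul_assoc]
      exact mul_le_mul_right h1 _
    have h4 : u = (u - P 0) + P 0 := by abel
    rw [h4, add_mul]
    refine (eLpNorm_add_le (hus.sub (hPm _)) (hPm _) hq1).trans (add_le_add ?_ h3)
    simpa using hq_sub 0
  · intro k
    refine ⟨c k, (hq_sub k).trans ?_⟩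
    gcongr
    exact le_self_add

/-- The main estimate needs an exponent at least p, so q is raised to the maximum of q and p. This
stays subcritical, because p itself lies below the critical exponent. -/
theorem one_div_sub_one_div_max_lt (hs : 0 < s) (hp : 1 < p) {q : ℝ≥0∞} (hq : q < pSharp s p) :
    1 / p - 1 / max q.toReal p < s := by
  have hp0 : 0 < p := one_pos.trans hp
  have hm : 0 < max q.toReal p := lt_max_of_lt_right hp0
  unfold pSharp at hq
  split_ifs at hq with h
  · have h1 : 0 < 1 - s * p := sub_pos.2 h
    have h2 : max q.toReal p < p / (1 - s * p) := by
      refine max_lt (ENNReal.toReal_lt_of_lt_ofReal hq) ?_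
      rw [lt_div_iff₀ h1]
      nlinarith [mul_pos (mul_pos hs hp0) hp0]
    have h3 := one_div_lt_one_div_of_lt hm h2
    rw [one_div_div] at h3
    have h4 : (1 - s * p) / p = 1 / p - s := by field_simp
    linarith
  · have h1 : 1 / p ≤ s := by rw [div_le_iff₀ hp0]; linarith
    have h2 : 0 < 1 / max q.toReal p := by positivity
    linarith

theorem CompactlyContained.exists_subset_shell {E : Type*} [NormedAddCommGroup E] {K : Set E}
    (hK : CompactlyContained K {0}ᶜ) :
    ∃ a b : ℝ, 0 < a ∧ a < b ∧ K ⊆ shell E a (b - a) := by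
  have h0 : (closure K)ᶜ ∈ nhds (0 : E) :=
    isClosed_closure.isOpen_compl.mem_nhds fun h => hK.closure_subset h rfl
  obtain ⟨a, ha, hball⟩ := Metric.mem_nhds_iff.1 h0
  obtain ⟨b, hab, hb⟩ := hK.isBounded.subset_ball_lt a 0
  refine ⟨a, b, ha, hab, fun x hx => ⟨?_, ?_⟩⟩
  · by_contra hxa
    exact hball (by simpa using hxa) (subset_closure hx)
  · simpa using hb hx

end Embedding

/-! ### The compact embedding. -/

theorem proposition4p1 (N : ℕ) (hN : 1 ≤ N) (s p R : ℝ) (hs0 : 0 < s) (hs1 : s < 1)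
    (hp : 1 < p) (hR : 0 < R) (q : ℝ≥0∞) [Fact (1 ≤ q)] (hq : q < pSharp s p)
    (K : Set (EuclideanSpace ℝ (Fin N))) (hK : CompactlyContained K {0}ᶜ) :
    EmbedsCompactly (D0rad N s p R) (gagliardo N s p) q (volume.restrict K) := by
  obtain ⟨a, b, ha, hab, hKsub⟩ := hK.exists_subset_shell
  set q₀ := max q.toReal p with hq₀
  have hq_top : q ≠ ∞ := (lt_of_lt_of_le hq le_top).ne
  have hqq₀ : q ≤ ENNReal.ofReal q₀ := by
    rw [← ENNReal.ofReal_toReal hq_top]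
    exact ENNReal.ofReal_le_ofReal (le_max_left _ _)
  have hq1 : (1 : ℝ≥0∞) ≤ q := Fact.out
  set A := shell (EuclideanSpace ℝ (Fin N)) a (b - a) with hA
  set ν := (volume : Measure (EuclideanSpace ℝ (Fin N))).restrict K with hν
  have hνA : ν ≤ volume.restrict A := Measure.restrict_mono hKsub le_rfl
  have : IsFiniteMeasure ν := ⟨by
    rw [hν, Measure.restrict_apply_univ]
    exact (measure_mono hKsub).trans_lt (measure_shell_lt_top volume _ _)⟩
  obtain ⟨C, r, hC, hr, hmain⟩ := exists_eLpNorm_radial_le hN hs0 hp.le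
    (le_max_right q.toReal p) (one_div_sub_one_div_max_lt hs0 hp hq) ha hab hR
  -- The Hölder factor for descending from q₀ to q on the finite measure space K.
  set T := ν Set.univ ^ (1 / q.toReal - 1 / (ENNReal.ofReal q₀).toReal) with hT
  have hexp : 0 ≤ 1 / q.toReal - 1 / (ENNReal.ofReal q₀).toReal := by
    rw [sub_nonneg]
    exact one_div_le_one_div_of_le
      (ENNReal.toReal_pos (one_pos.trans_le hq1).ne' hq_top)
      (ENNReal.toReal_mono ENNReal.ofReal_ne_top hqq₀)
  have hTf : T ≠ ∞ := ENNReal.rpow_ne_top_of_nonneg hexp (measure_ne_top _ _)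
  have hlow : ∀ g : EuclideanSpace ℝ (Fin N) → ℝ, Measurable g →
      eLpNorm g q ν ≤ eLpNorm g (ENNReal.ofReal q₀) (volume.restrict A) * T := fun g hg =>
    (eLpNorm_le_eLpNorm_mul_rpow_measure_univ hqq₀ hg.aestronglyMeasurable).trans
      (mul_le_mul_left (eLpNorm_mono_measure g hνA) T)
  have hCT : C * T ≠ ∞ := ENNReal.mul_ne_top hC hTf
  have key : ∀ u ∈ D0rad N s p R, AEStronglyMeasurable u ν ∧
      eLpNorm u q ν ≤ C * T * gagliardo N s p u ∧
      ∀ k : ℕ, ∃ c : ℕ → ℝ, eLpNorm (fun x => u x - c (radialIndex a b k x)) q ν ≤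
        C * T * r ^ k * gagliardo N s p u := by
    -- All quantities are invariant under a.e. equality, so u may be replaced by its measurable
    -- radial profile.
    rintro u ⟨hu, f, hf, huf⟩
    have hfm : Measurable fun x : EuclideanSpace ℝ (Fin N) => f ‖x‖ := hf.comp measurable_norm
    have hG : gagliardo N s p u = gagliardo N s p fun x => f ‖x‖ := gagliardo_congr huf
    have h0 : ∀ᵐ x : EuclideanSpace ℝ (Fin N), x ∉ Metric.ball 0 R → f ‖x‖ = 0 := by
      filter_upwards [hu.eq_zero_outside, huf] with x hx hxf hxR
      rw [← hxf, hx hxR]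
    obtain ⟨hb1, hb2⟩ := hmain f hf h0 (hG ▸ hu.gagliardo_lt_top.ne)
    have hufν : ∀ᵐ x ∂ν, u x = f ‖x‖ := ae_restrict_of_ae huf
    refine ⟨hu.aestronglyMeasurable.restrict, ?_, fun k => ?_⟩
    · rw [eLpNorm_congr_ae hufν, hG, mul_right_comm]
      exact (hlow _ hfm).trans (mul_le_mul_left hb1 T)
    · obtain ⟨c, hc⟩ := hb2 k
      refine ⟨c, ?_⟩
      have h1 : (fun x => u x - c (radialIndex a b k x)) =ᵐ[ν]
          fun x => f ‖x‖ - c (radialIndex a b k x) := by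
        filter_upwards [hufν] with x hx
        rw [hx]
      rw [eLpNorm_congr_ae h1, hG]
      refine (hlow _ (hfm.sub (measurable_from_nat.comp (measurable_radialIndex k)))).trans ?_
      refine (mul_le_mul_left hc T).trans (le_of_eq ?_)
      ring
  refine ⟨fun u hu => ⟨(key u hu).1, (key u hu).2.1.trans_lt ?_⟩, ⟨(C * T).toNNReal, ?_⟩,
    fun M => ?_⟩
  · exact ENNReal.mul_lt_top hCT.lt_top hu.1.gagliardo_lt_top
  · intro u hu
    rw [ENNReal.coe_toNNReal hCT]
    exact (key u hu).2.1
  · refine isCompact_closure_of_forall_finiteDimensional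
      ⟨(C * T * M).toReal, ?_⟩ fun ε hε => ?_
    · rintro f ⟨u, hu, huM, hfu⟩
      rw [Lp.norm_def, eLpNorm_congr_ae hfu]
      refine ENNReal.toReal_mono (ENNReal.mul_ne_top hCT ENNReal.coe_ne_top) ?_
      exact (key u hu).2.1.trans (mul_le_mul_right huM _)
    · have hlim : Filter.Tendsto (fun k : ℕ => C * T * r ^ k * M) Filter.atTop (nhds 0) := by
        have h1 := ENNReal.Tendsto.const_mul (a := C * T)
          (ENNReal.tendsto_pow_atTop_nhds_zero_of_lt_one hr) (Or.inr hCT)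
        have h2 := ENNReal.Tendsto.mul_const (b := (M : ℝ≥0∞)) h1 (Or.inr ENNReal.coe_ne_top)
        simpa using h2
      -- The generation k depends only on ε and M, so a single space V of step functions serves
      -- every u with seminorm at most M.
      obtain ⟨k, hk⟩ := (hlim.eventually
        (ge_mem_nhds (ENNReal.ofReal_pos.2 hε))).exists
      have hlt : ∀ᵐ x ∂ν, radialIndex a b k x < 2 ^ k :=
        ae_mono hνA (by
          filter_upwards [ae_restrict_mem (measurableSet_shell a (b - a))] with x hx
          exact radialIndex_lt hab k hx)
      obtain ⟨V, hV, hVstep⟩ := exists_finiteDimensional_step (μ := ν) q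
        (measurable_radialIndex (a := a) (b := b) k) hlt
      refine ⟨V, hV, ?_⟩
      rintro f ⟨u, hu, huM, hfu⟩
      obtain ⟨c, hc⟩ := (key u hu).2.2 k
      obtain ⟨g, hgV, hg⟩ := hVstep c
      refine ⟨g, hgV, ?_⟩
      have hfg : ((f - g : Lp ℝ q ν) : EuclideanSpace ℝ (Fin N) → ℝ) =ᵐ[ν]
          fun x => u x - c (radialIndex a b k x) := by
        filter_upwards [Lp.coeFn_sub f g, hfu, hg] with x h1 h2 h3
        rw [h1, Pi.sub_apply, h2, h3]
      rw [Lp.norm_def, eLpNorm_congr_ae hfg]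
      refine ENNReal.toReal_le_of_le_ofReal hε.le ?_
      exact (hc.trans (mul_le_mul_right huM _)).trans hk
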